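/- Let $\mathbb{F}$ be an arbitrary field, and let $n \geq p \geq r > 0$ be integers. Assume that $|\mathbb{F}| > r+1$ (in particular, $\mathbb{F}$ may be infinite). Then the greatest possible dimension of a (nonempty) affine subspace of the space $\mathrm{M}_{n,p}(\mathbb{F})$ of $n \times p$ matrices with entries in $\mathbb{F}$ in which every matrix has rank exactly $r$ equals $$\binom{r}{2} + r(n-r).$$ That is, every such affine subspace has dimension at most $\binom{r}{2}+r(n-r)$, and some such affine subspace has exactly this dimension. -/

import Mathlib

open Module Polynomial

/-! Change bases so that a chosen point of the affine space becomes `J = fromBlocks 1 0 0 0`, with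
`1` of size `r`, and let `V` be the direction. For `M = fromBlocks A C B D` in `V`, every `J + t •
M` has rank at most `r`, so its bordered `r + 1` minors vanish as polynomials in `t`; this forces `D
= 0` and `B * C = 0`. By polarization, the pairs `(B, C)` span at most `r * (n - r)` dimensions.
What remains is the matrices with only the block `A`: there `1 - A` is invertible, so `1` is never
an eigenvalue, and induction on the size bounds this part by `r.choose 2`. -/

theorem Submodule.finrank_eq_finrank_map_add_finrank_inf_ker {F X Y : Type*} [Field F]
    [AddCommGroup X] [Module F X] [AddCommGroup Y] [Module F Y] [FiniteDimensional F X]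
    (V : Submodule F X) (f : X →ₗ[F] Y) :
    finrank F V = finrank F (V.map f) + finrank F (V ⊓ LinearMap.ker f : Submodule F X) := by
  rw [← LinearMap.finrank_range_add_finrank_ker (f.domRestrict V), LinearMap.range_domRestrict,
    LinearMap.ker_domRestrict, ← Submodule.finrank_map_subtype_eq, Submodule.map_comap_subtype]

/-! ### Spaces of square matrices without eigenvalue `1` -/

/-- The hyperplanes orthogonal to the `v i` are fewer than the elements of `F`, so they cannot cover
the space. -/
theorem exists_dotProduct_ne_zero {F ι : Type*} [Field F] [Fintype ι]
    (hF : (Fintype.card ι : ℕ∞) < ENat.card F) (v : ι → ι → F) (hv : ∀ i, v i ≠ 0) :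
    ∃ y : ι → F, ∀ i, y ⬝ᵥ v i ≠ 0 := by
  classical
  obtain ⟨y, -, hy⟩ := Set.exists_of_ssubset <|
    Submodule.iUnion_ssubset_of_forall_ne_top_of_card_lt Finset.univ
      (fun i ↦ LinearMap.ker (dotProductEquiv F ι (v i)))
      (fun i hi ↦ hv i (by simpa [LinearMap.ker_eq_top] using hi)) (by simpa using hF)
  refine ⟨y, fun i hi ↦ hy ?_⟩
  rw [dotProduct_comm] at hi
  simpa using ⟨i, hi⟩

/-- A space of square matrices none of which has `1` as an eigenvalue contains, for some index `i`,
no nonzero matrix supported on the column `i`. -/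
theorem exists_column_injective {F ι : Type*} [Field F] [Fintype ι] [DecidableEq ι] [Nonempty ι]
    (hF : (Fintype.card ι : ℕ∞) < ENat.card F) (V : Submodule F (Matrix ι ι F))
    (hV : ∀ M ∈ V, ∀ y : ι → F, Matrix.vecMul y M = y → y = 0) :
    ∃ i, ∀ M ∈ V, (∀ a b, b ≠ i → M a b = 0) → M = 0 := by
  by_contra! h
  choose M hMV hM hM0 using h
  obtain ⟨y, hy⟩ := exists_dotProduct_ne_zero hF (fun i a ↦ M i a i) (by
    intro i hi
    apply hM0 i
    ext a b
    by_cases hb : b = i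
    · subst hb; exact congrFun hi a
    · exact hM i a b hb)
  -- Each `M i` affects only coordinate `i` of the product, so these weights make `y` a left fixed
  -- vector.
  have hy0 := hV (∑ i, (y i / (y ⬝ᵥ fun a ↦ M i a i)) • M i)
    (V.sum_mem fun i _ ↦ V.smul_mem _ (hMV i)) y (by
      ext j
      have hcol : ∀ a, (∑ i, (y i / (y ⬝ᵥ fun a ↦ M i a i)) • M i) a j =
          y j / (y ⬝ᵥ fun a ↦ M j a j) * M j a j := by
        intro a
        rw [Matrix.sum_apply, Finset.sum_eq_single j]
        · simp
        · intro i _ hij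
          simp [hM i a j hij.symm]
        · simp
      change ∑ a, y a * (∑ i, (y i / (y ⬝ᵥ fun a ↦ M i a i)) • M i) a j = y j
      simp only [hcol, mul_left_comm (y _), ← Finset.mul_sum]
      exact div_mul_cancel₀ _ (hy j))
  obtain ⟨i⟩ := ‹Nonempty ι›
  exact hy i (by simp [hy0])

/-- A space of `k × k` matrices none of which has `1` as an eigenvalue has dimension at most
`k.choose 2`. -/
theorem finrank_le_choose_two_of_vecMul_ne {F : Type*} [Field F] (k : ℕ)
    (hF : (k : ℕ∞) < ENat.card F) {ι : Type*} [Fintype ι] [DecidableEq ι]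
    (hι : Fintype.card ι = k) (V : Submodule F (Matrix ι ι F))
    (hV : ∀ M ∈ V, ∀ y : ι → F, Matrix.vecMul y M = y → y = 0) :
    finrank F V ≤ k.choose 2 := by
  induction k generalizing ι with
  | zero =>
    have := Fintype.card_eq_zero_iff.1 hι
    simp [finrank_zero_of_subsingleton]
  | succ k ih =>
    have : Nonempty ι := Fintype.card_pos_iff.1 (by omega)
    obtain ⟨i, hi⟩ := exists_column_injective (by rwa [hι]) V hV
    let row : Matrix ι ι F →ₗ[F] (ι → F) := LinearMap.proj i
    let cut : Matrix ι ι F →ₗ[F] Matrix {j // j ≠ i} {j // j ≠ i} F :=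
      { toFun := fun M ↦ M.submatrix Subtype.val Subtype.val
        map_add' := fun _ _ ↦ rfl
        map_smul' := fun _ _ ↦ rfl }
    have hrow : finrank F (V.map row) ≤ k := by
      -- A matrix whose row `i` is the basis vector `e_i` would fix `e_i`.
      have hne : V.map row ≠ ⊤ := by
        intro htop
        obtain ⟨M, hM, hMi⟩ := htop.symm ▸ (Submodule.mem_top : Pi.single i (1 : F) ∈ ⊤)
        have := hV M hM (Pi.single i 1) (by rw [Matrix.single_one_vecMul]; exact hMi)
        simpa using congrFun this i
      have := Submodule.finrank_lt (lt_top_iff_ne_top.2 hne).ne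
      rw [finrank_pi, hι] at this
      omega
    have hker : (V ⊓ LinearMap.ker row) ⊓ LinearMap.ker cut = ⊥ := by
      rw [eq_bot_iff]
      rintro M ⟨⟨hM, hMr⟩, hMc⟩
      refine hi M hM fun a b hb ↦ ?_
      by_cases ha : a = i
      · subst ha; exact congrFun hMr b
      · exact congrFun (congrFun hMc ⟨a, ha⟩) ⟨b, hb⟩
    have hcut : finrank F ((V ⊓ LinearMap.ker row).map cut) ≤ k.choose 2 := by
      refine ih (lt_of_le_of_lt (by exact_mod_cast k.le_succ) hF)
        (by rw [Fintype.card_subtype_compl]; simp [hι]) _ ?_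
      rintro _ ⟨M, ⟨hM, hMr⟩, rfl⟩ y hy
      have hMi : ∀ b, M i b = 0 := fun b ↦ congrFun hMr b
      -- Row `i` of `M` vanishes, so `z M` does not depend on `z i`; setting `z i` to the resulting
      -- coordinate extends the fixed vector `y` to one of `M`.
      let z : ι → F := fun a ↦ if h : a = i then ∑ j : {j // j ≠ i}, y j * M j i else y ⟨a, h⟩
      have hz : ∀ b, Matrix.vecMul z M b = ∑ j : {j // j ≠ i}, y j * M j b := by
        intro b
        rw [Matrix.vecMul, dotProduct, ← Fintype.sum_subtype_add_sum_subtype (fun a ↦ a ≠ i)]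
        rw [Finset.sum_eq_zero (s := (Finset.univ : Finset {a // ¬ a ≠ i})), add_zero]
        · refine Finset.sum_congr rfl fun j _ ↦ ?_
          simp [z, j.2]
        · rintro ⟨a, ha⟩ -
          rw [not_not] at ha
          subst ha
          simp [hMi]
      have hz0 := hV M hM z (by
        ext b
        rw [hz]
        by_cases hb : b = i
        · subst hb; simp [z]
        · simp only [z, hb, dif_neg, not_false_iff]
          exact congrFun hy ⟨b, hb⟩)
      ext j
      simpa [z, j.2] using congrFun hz0 j
    rw [V.finrank_eq_finrank_map_add_finrank_inf_ker row,
      (V ⊓ LinearMap.ker row).finrank_eq_finrank_map_add_finrank_inf_ker cut, hker,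
      Nat.choose_succ_succ, Nat.choose_one_right, finrank_bot]
    exact add_le_add hrow hcut

/-! ### Pairs of maps with zero composite -/

/-- A bound on the dimension of a space of pairs of composable linear maps with zero composite. -/
theorem finrank_le_of_comp_eq_zero {F E G H : Type*} [Field F] [AddCommGroup E] [Module F E]
    [AddCommGroup G] [Module F G] [AddCommGroup H] [Module F H] [FiniteDimensional F E]
    [FiniteDimensional F G] [FiniteDimensional F H] (hHG : finrank F H ≤ finrank F G)
    (W : Submodule F ((E →ₗ[F] G) × (H →ₗ[F] E))) (hW : ∀ w ∈ W, w.1 ∘ₗ w.2 = 0) :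
    finrank F W ≤ finrank F E * finrank F G := by
  -- Adding `(0, c)` to `w` in `W` gives `w.1 ∘ c = 0`, so every first component kills `T` and
  -- factors through `E ⧸ T`, while the second components of pairs `(0, c)` land in `T`.
  let T : Submodule F E := ⨆ c : {c : H →ₗ[F] E // (0, c) ∈ W}, LinearMap.range c.1
  have h1 : W.map (LinearMap.fst F _ _) ≤ LinearMap.range (LinearMap.lcomp F G T.mkQ) := by
    rintro _ ⟨w, hw, rfl⟩
    have hT : T ≤ LinearMap.ker w.1 := by
      refine iSup_le ?_
      rintro ⟨c, hc⟩ _ ⟨x, rfl⟩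
      have h2 := hW _ (W.add_mem hw hc)
      have h3 := LinearMap.congr_fun h2 x
      have h4 := LinearMap.congr_fun (hW w hw) x
      have h5 : w.1 (w.2 x) = 0 := h4
      simpa [h5] using h3
    exact ⟨T.liftQ w.1 hT, by ext x; simp⟩
  have h2 : (W ⊓ LinearMap.ker (LinearMap.fst F _ _)) ≤
      LinearMap.range (LinearMap.inr F (E →ₗ[F] G) (H →ₗ[F] E) ∘ₗ
        T.subtype.compRight F) := by
    rintro ⟨b, c⟩ ⟨hw, hb⟩
    obtain rfl : b = 0 := hb
    refine ⟨c.codRestrict T fun x ↦ ?_, by ext <;> simp⟩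
    exact Submodule.mem_iSup_of_mem ⟨c, hw⟩ ⟨x, rfl⟩
  have h1' := (Submodule.finrank_mono h1).trans (LinearMap.finrank_range_le _)
  have h2' := (Submodule.finrank_mono h2).trans (LinearMap.finrank_range_le _)
  rw [finrank_linearMap] at h1' h2'
  rw [W.finrank_eq_finrank_map_add_finrank_inf_ker (LinearMap.fst F _ _)]
  have := T.finrank_quotient_add_finrank
  calc _ ≤ finrank F (E ⧸ T) * finrank F G + finrank F G * finrank F T :=
        add_le_add h1' (h2'.trans (Nat.mul_le_mul_right _ hHG))
    _ = _ := by rw [← this]; ring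

/-! ### Block form of the rank condition -/

theorem Matrix.det_eq_zero_of_rank_lt {F ι : Type*} [Field F] [Fintype ι] [DecidableEq ι]
    (M : Matrix ι ι F) (h : M.rank < Fintype.card ι) : M.det = 0 := by
  by_contra h0
  exact h.ne (Matrix.rank_of_det_ne_zero h0)

/-- If the line through `fromBlocks 1 0 0 0` directed by `fromBlocks A C B D` consists of matrices of
rank at most that of the identity block, then `D = 0` and `B * C = 0`. -/
theorem blocks_eq_zero_of_rank_le {F ι κ μ : Type*} [Field F] [Fintype ι] [DecidableEq ι]
    [Fintype κ] [Fintype μ] (hF : ((Fintype.card ι + 1 : ℕ) : Cardinal) < Cardinal.mk F)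
    (A : Matrix ι ι F) (C : Matrix ι μ F) (B : Matrix κ ι F) (D : Matrix κ μ F)
    (h : ∀ t : F, (Matrix.fromBlocks 1 0 0 0 + t • Matrix.fromBlocks A C B D).rank ≤
      Fintype.card ι) : D = 0 ∧ B * C = 0 := by
  classical
  suffices H : ∀ i j, D i j = 0 ∧ (B * C) i j = 0 from
    ⟨Matrix.ext fun i j ↦ (H i j).1, Matrix.ext fun i j ↦ (H i j).2⟩
  intro i j
  let c : Matrix ι Unit F := C.submatrix id fun _ ↦ j
  let b : Matrix Unit ι F := B.submatrix (fun _ ↦ i) id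
  let d : Matrix Unit Unit F := D.submatrix (fun _ ↦ i) fun _ ↦ j
  let J : Matrix (ι ⊕ Unit) (ι ⊕ Unit) F := Matrix.fromBlocks 1 0 0 0
  let N : Matrix (ι ⊕ Unit) (ι ⊕ Unit) F := Matrix.fromBlocks A c b d
  have hP : Matrix.det ((X : F[X]) • N.map Polynomial.C + J.map Polynomial.C) = 0 := by
    -- The determinant has degree at most `card ι + 1`, so `card ι + 2` roots are needed; this is
    -- where the size of `F` enters in full.
    obtain ⟨s, hs⟩ := Cardinal.exists_finset_le_card F (Fintype.card ι + 2) (by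
      have := Order.succ_le_of_lt hF
      rw [Cardinal.succ_natCast] at this
      exact_mod_cast this)
    refine eq_zero_of_natDegree_lt_card_of_eval_eq_zero' _ s (fun t _ ↦ ?_)
      ((natDegree_det_X_add_C_le N J).trans_lt (by simp; omega))
    have hmat : (Polynomial.evalRingHom t).mapMatrix
        ((X : F[X]) • N.map Polynomial.C + J.map Polynomial.C) =
        (Matrix.fromBlocks 1 0 0 0 + t • Matrix.fromBlocks A C B D).submatrix
          (Sum.map id fun _ : Unit ↦ i) (Sum.map id fun _ : Unit ↦ j) := by
      ext (x | x) (y | y)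
      · rcases eq_or_ne x y with rfl | hxy
        · simp [N, J, add_comm, mul_comm t]
        · simp [N, J, hxy, mul_comm t]
      all_goals simp [N, J, c, b, d, mul_comm t]
    rw [← Polynomial.coe_evalRingHom, RingHom.map_det, hmat]
    apply Matrix.det_eq_zero_of_rank_lt
    refine (Matrix.rank_submatrix_le _ _ _).trans_lt ((h t).trans_lt ?_)
    simp
  let P : Matrix ι ι F[X] := 1 + (X : F[X]) • A.map Polynomial.C
  let c' := c.map Polynomial.C
  let b' := b.map Polynomial.C
  -- Cancel `X` from the last column; at `X = 0` the determinant is then `d`.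
  have hQ : Matrix.det (Matrix.fromBlocks P c' ((X : F[X]) • b') (d.map Polynomial.C)) = 0 := by
    have hmul : (X : F[X]) • N.map Polynomial.C + J.map Polynomial.C =
        Matrix.fromBlocks P c' ((X : F[X]) • b') (d.map Polynomial.C) *
          Matrix.fromBlocks 1 0 0 ((X : F[X]) • 1) := by
      rw [Matrix.fromBlocks_multiply]
      ext1 (x | x) (y | y)
      · rcases eq_or_ne x y with rfl | hxy
        · simp [N, J, P, add_comm]
        · simp [N, J, P, hxy]
      all_goals simp [N, J, c', b']
    rw [hmul, Matrix.det_mul] at hP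
    exact (mul_eq_zero.1 hP).resolve_right (by simp)
  have heval : ∀ (b : Matrix Unit ι F[X]) (d : Matrix Unit Unit F),
      Matrix.det (Matrix.fromBlocks P c' b (d.map Polynomial.C)) = 0 →
      Matrix.det (Matrix.fromBlocks 1 c (b.map (Polynomial.eval 0)) d) = 0 := by
    intro b d h0
    refine Eq.trans ?_ ((congrArg (Polynomial.evalRingHom 0) h0).trans (map_zero _))
    rw [RingHom.map_det]
    clear h0
    congr 1
    ext (x | x) (y | y)
    · rcases eq_or_ne x y with rfl | hxy
      · simp [P]
      · simp [P, hxy]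
    all_goals simp [c']
  have hd : D i j = 0 := by
    have h0 := heval _ _ hQ
    rw [Matrix.det_fromBlocks_one₁₁] at h0
    simpa [b', d, Matrix.mul_apply] using h0
  refine ⟨hd, ?_⟩
  have hd' : d = 0 := by ext; exact hd
  -- Now that `d = 0`, the last row is divisible by `X` as well; after cancelling, the value at `0`
  -- is `-(b * c)`.
  have hR : Matrix.det (Matrix.fromBlocks P c' b' ((0 : Matrix Unit Unit F).map Polynomial.C)) = 0 := by
    have hmul : Matrix.fromBlocks P c' ((X : F[X]) • b') (d.map Polynomial.C) =
        Matrix.fromBlocks 1 0 0 ((X : F[X]) • 1) *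
          Matrix.fromBlocks P c' b' ((0 : Matrix Unit Unit F).map Polynomial.C) := by
      rw [Matrix.fromBlocks_multiply, hd']
      simp
    rw [hmul, Matrix.det_mul] at hQ
    exact (mul_eq_zero.1 hQ).resolve_left (by simp)
  have h0 := heval _ _ hR
  rw [Matrix.det_fromBlocks_one₁₁] at h0
  simpa [b', b, c, Matrix.mul_apply] using h0

theorem LinearMap.exists_basis_toMatrix_eq_fromBlocks {F X Y : Type*} [Field F]
    [AddCommGroup X] [Module F X] [FiniteDimensional F X]
    [AddCommGroup Y] [Module F Y] [FiniteDimensional F Y] (f : X →ₗ[F] Y) {r s t : ℕ}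
    (hr : finrank F (LinearMap.range f) = r) (hX : finrank F X = r + s)
    (hY : finrank F Y = r + t) :
    ∃ (b : Basis (Fin r ⊕ Fin s) F X) (b' : Basis (Fin r ⊕ Fin t) F Y),
      LinearMap.toMatrix b b' f = Matrix.fromBlocks 1 0 0 0 := by
  obtain ⟨K, hK⟩ := (LinearMap.ker f).exists_isCompl
  obtain ⟨R, hR⟩ := (LinearMap.range f).exists_isCompl
  let e := f.kerComplementEquivRange hK.symm
  have h1 := LinearMap.finrank_range_add_finrank_ker f
  have h2 := Submodule.finrank_add_eq_of_isCompl hR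
  let bK : Basis (Fin r) F K := finBasisOfFinrankEq F K (by rw [e.finrank_eq, hr])
  let bk : Basis (Fin s) F (LinearMap.ker f) := finBasisOfFinrankEq F _ (by omega)
  let bR : Basis (Fin t) F R := finBasisOfFinrankEq F _ (by omega)
  refine ⟨(bK.prod bk).map (Submodule.prodEquivOfIsCompl _ _ hK.symm),
    ((bK.map e).prod bR).map (Submodule.prodEquivOfIsCompl _ _ hR), ?_⟩
  ext a b
  rw [LinearMap.toMatrix_apply]
  rcases b with b | b
  · have : f (((bK.prod bk).map (Submodule.prodEquivOfIsCompl _ _ hK.symm)) (Sum.inl b)) =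
        ((bK.map e).prod bR).map (Submodule.prodEquivOfIsCompl _ _ hR) (Sum.inl b) := by
      simp [e]
    rw [this, Basis.repr_self]
    rcases a with a | a <;> simp [Finsupp.single_apply, Matrix.one_apply, eq_comm]
  · have : f (((bK.prod bk).map (Submodule.prodEquivOfIsCompl _ _ hK.symm)) (Sum.inr b)) = 0 := by
      simp
    rw [this, map_zero]
    rcases a with a | a <;> simp
-- An extremal example
/-- There is an affine space of rank `r` matrices attaining the bound: the `n × p` matrices with ones on the first `r` diagonal entries, arbitrary
entries below them, and zeros elsewhere. -/
theorem exists_affineSubspace_rank_eq {F : Type*} [Field F] {n p r : ℕ} (hpn : p ≤ n)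
    (hrp : r ≤ p) :
    ∃ S : AffineSubspace F (Matrix (Fin n) (Fin p) F),
      (S : Set (Matrix (Fin n) (Fin p) F)).Nonempty ∧ (∀ M ∈ S, M.rank = r) ∧
      finrank F S.direction = r.choose 2 + r * (n - r) := by
  classical
  let I := Σ j : Fin r, {i : Fin n // j.1 < i.1}
  let pos : I → Fin n × Fin p := fun x ↦ (x.2.1, Fin.castLE hrp x.1)
  have hpos : Function.Injective pos := by
    rintro ⟨j, i⟩ ⟨j', i'⟩ h
    simp only [pos, Prod.mk.injEq] at h
    obtain rfl : j = j' := Fin.castLE_injective hrp h.2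
    rw [Subtype.ext h.1]
  let L : (I → F) →ₗ[F] Matrix (Fin n) (Fin p) F :=
    { toFun := fun v i j ↦ Function.extend pos v 0 (i, j)
      map_add' := fun v w ↦ by
        ext i j
        simpa using! congrFun (Function.extend_add pos v w 0 0) (i, j)
      map_smul' := fun a v ↦ by
        ext i j
        simpa using! congrFun (Function.extend_smul a pos v 0) (i, j) }
  have hLinj : Function.Injective L := fun v w h ↦ by
    ext x
    have h' : Function.extend pos v 0 (pos x) = Function.extend pos w 0 (pos x) :=
      congrFun (congrFun h (pos x).1) (pos x).2
    simpa only [hpos.extend_apply] using h'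
  have hL0 : ∀ v i j, ¬ (j.1 < r ∧ j.1 < i.1) → L v i j = 0 := by
    intro v i j h
    refine Function.extend_apply' _ _ _ ?_
    rintro ⟨⟨a, b⟩, hab⟩
    simp only [pos, Prod.mk.injEq] at hab
    obtain ⟨rfl, rfl⟩ := hab
    exact h ⟨a.2, b.2⟩
  let J : Matrix (Fin n) (Fin p) F := Matrix.of fun i j ↦ if i.1 = j.1 ∧ j.1 < r then 1 else 0
  refine ⟨AffineSubspace.mk' J (LinearMap.range L), AffineSubspace.mk'_nonempty _ _, ?_, ?_⟩
  · intro M hM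
    rw [AffineSubspace.mem_mk'] at hM
    obtain ⟨v, hv⟩ := hM
    obtain rfl : M = L v + J := by rw [hv]; simp
    apply le_antisymm
    · rw [← Matrix.rank_transpose]
      refine (Matrix.rank_le_card_of_support_subset _
        (Finset.univ.filter fun j : Fin p ↦ j.1 < r) fun j hj ↦ ?_).trans ?_
      · by_contra hjr
        apply hj
        ext i
        have : ¬ j.1 < r := by simpa using hjr
        simp [Matrix.row, hL0 v i j (by tauto), J, this]
      · rw [Fin.card_filter_val_lt]; exact min_le_right _ _
    -- The leading `r × r` submatrix is lower triangular with unit diagonal.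
    · have hdet : ((L v + J).submatrix (Fin.castLE (hrp.trans hpn)) (Fin.castLE hrp)).det = 1 := by
        rw [Matrix.det_of_isLowerTriangular]
        · refine Finset.prod_eq_one fun i _ ↦ ?_
          simp [hL0 v (Fin.castLE (hrp.trans hpn) i) (Fin.castLE hrp i) (by simp), J]
        · intro i j hij
          have hij : i < j := hij
          have : i.1 < j.1 := hij
          simp [hL0 v (Fin.castLE (hrp.trans hpn) i) (Fin.castLE hrp j) (by simp; omega), J, this.ne]
      have := Matrix.rank_of_det_ne_zero (hdet.trans_ne one_ne_zero)
      rw [Fintype.card_fin] at this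
      exact this.symm.le.trans (Matrix.rank_submatrix_le _ _ _)
  · rw [AffineSubspace.direction_mk', LinearMap.finrank_range_of_inj hLinj, finrank_pi,
      Fintype.card_sigma]
    have hcard : ∀ j : Fin r, Fintype.card {i : Fin n // j.1 < i.1} = n - 1 - j := by
      intro j
      have := Fin.card_Ioi (⟨j, by omega⟩ : Fin n)
      rw [Fintype.card_subtype]
      rw [← this]
      congr 1
      ext; simp [Fin.lt_def]
    simp only [hcard]
    rw [Fin.sum_univ_eq_sum_range (fun j ↦ n - 1 - j) r]
    have hrn := hrp.trans hpn
    clear * - hrn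
    induction r with
    | zero => simp
    | succ r ih =>
      obtain ⟨m, rfl⟩ := Nat.exists_eq_add_of_le hrn
      rw [Finset.sum_range_succ, ih (by omega), Nat.choose_succ_succ, Nat.choose_one_right,
        show r + 1 + m - r = m + 1 by omega, show r + 1 + m - 1 - r = m by omega,
        show r + 1 + m - (r + 1) = m by omega]
      ring

/-! ### The upper bound -/

theorem Matrix.rank_lt_card_of_det_eq_zero {F ι : Type*} [Field F] [Fintype ι] [DecidableEq ι]
    (M : Matrix ι ι F) (h : M.det = 0) : M.rank < Fintype.card ι := by
  obtain ⟨v, hv, hMv⟩ := Matrix.exists_mulVec_eq_zero_iff.2 h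
  have h1 := LinearMap.finrank_range_add_finrank_ker M.mulVecLin
  have h2 : 0 < finrank F (LinearMap.ker M.mulVecLin) :=
    finrank_pos_iff_exists_ne_zero.2 ⟨⟨v, hMv⟩, fun h ↦ hv (congrArg Subtype.val h)⟩
  rw [finrank_pi] at h1
  change finrank F (LinearMap.range M.mulVecLin) < _
  omega

/-- The dimension bound for constant rank affine spaces through `fromBlocks 1 0 0 0`. -/
theorem finrank_le_of_forall_rank_eq {F ι κ μ : Type*} [Field F] [Fintype ι] [DecidableEq ι]
    [Fintype κ] [Fintype μ] (hF : ((Fintype.card ι + 1 : ℕ) : Cardinal) < Cardinal.mk F)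
    (hμκ : Fintype.card μ ≤ Fintype.card κ) (V : Submodule F (Matrix (ι ⊕ κ) (ι ⊕ μ) F))
    (hV : ∀ M ∈ V, (Matrix.fromBlocks 1 0 0 0 + M).rank = Fintype.card ι) :
    finrank F V ≤ (Fintype.card ι).choose 2 + Fintype.card ι * Fintype.card κ := by
  classical
  have hblocks : ∀ M ∈ V, M.toBlocks₂₂ = 0 ∧ M.toBlocks₂₁ * M.toBlocks₁₂ = 0 := fun M hM ↦
    blocks_eq_zero_of_rank_le hF M.toBlocks₁₁ M.toBlocks₁₂ M.toBlocks₂₁ M.toBlocks₂₂ fun t ↦ by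
      rw [Matrix.fromBlocks_toBlocks]
      exact (hV _ (V.smul_mem t hM)).le
  let side : Matrix (ι ⊕ κ) (ι ⊕ μ) F →ₗ[F]
      ((ι → F) →ₗ[F] (κ → F)) × ((μ → F) →ₗ[F] (ι → F)) :=
    { toFun := fun M ↦ (Matrix.toLin' M.toBlocks₂₁, Matrix.toLin' M.toBlocks₁₂)
      map_add' := fun M N ↦ Prod.ext (map_add Matrix.toLin' M.toBlocks₂₁ N.toBlocks₂₁)
        (map_add Matrix.toLin' M.toBlocks₁₂ N.toBlocks₁₂)
      map_smul' := fun a M ↦ Prod.ext (map_smul Matrix.toLin' a M.toBlocks₂₁)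
        (map_smul Matrix.toLin' a M.toBlocks₁₂) }
  let corner : Matrix (ι ⊕ κ) (ι ⊕ μ) F →ₗ[F] Matrix ι ι F :=
    { toFun := fun M ↦ M.toBlocks₁₁
      map_add' := fun _ _ ↦ rfl
      map_smul' := fun _ _ ↦ rfl }
  have hside : finrank F (V.map side) ≤ Fintype.card ι * Fintype.card κ := by
    have := finrank_le_of_comp_eq_zero (by simpa using hμκ) (V.map side) (by
      rintro _ ⟨M, hM, rfl⟩
      change Matrix.toLin' _ ∘ₗ Matrix.toLin' _ = 0
      rw [← Matrix.toLin'_mul, (hblocks M hM).2, map_zero])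
    simpa using this
  have hzero : ∀ M ∈ V ⊓ LinearMap.ker side, M = Matrix.fromBlocks M.toBlocks₁₁ 0 0 0 := by
    rintro M ⟨hM, hMs⟩
    have h21 : M.toBlocks₂₁ = 0 := Matrix.toLin'.map_eq_zero_iff.1 (congrArg Prod.fst hMs)
    have h12 : M.toBlocks₁₂ = 0 := Matrix.toLin'.map_eq_zero_iff.1 (congrArg Prod.snd hMs)
    conv_lhs => rw [← M.fromBlocks_toBlocks, h21, h12, (hblocks M hM).1]
  have hker : (V ⊓ LinearMap.ker side) ⊓ LinearMap.ker corner = ⊥ := by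
    rw [eq_bot_iff]
    rintro M ⟨hM, hMc⟩
    have h11 : M.toBlocks₁₁ = 0 := hMc
    rw [Submodule.mem_bot, hzero M hM, h11, Matrix.fromBlocks_zero]
  have hcorner : finrank F ((V ⊓ LinearMap.ker side).map corner) ≤ (Fintype.card ι).choose 2 := by
    refine finrank_le_choose_two_of_vecMul_ne _ ?_ rfl _ ?_
    · exact Cardinal.natCast_lt_toENat.2 (lt_of_le_of_lt (by simp) hF)
    rintro _ ⟨M, hM, rfl⟩ y hy
    -- The sign turns invertibility of `1 + A` into that of `1 - A`, which excludes the eigenvalue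
    -- `1`.
    have hrank := hV (-M) (V.neg_mem hM.1)
    have hsplit : Matrix.fromBlocks 1 0 0 0 + -M =
        Matrix.fromRows (1 : Matrix ι ι F) (0 : Matrix κ ι F) *
          ((1 - M.toBlocks₁₁) * Matrix.fromCols (1 : Matrix ι ι F) (0 : Matrix ι μ F)) := by
      conv_lhs => rw [hzero M hM]
      rw [Matrix.mul_fromCols, Matrix.fromRows_mul_fromCols, Matrix.fromBlocks_neg,
        Matrix.fromBlocks_add]
      simp [sub_eq_add_neg]
    rw [hsplit] at hrank
    have hle := hrank.symm.le.trans
      ((Matrix.rank_mul_le_right _ _).trans (Matrix.rank_mul_le_left _ _))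
    have hdet : (1 - M.toBlocks₁₁).det ≠ 0 := fun h0 ↦
      hle.not_gt (Matrix.rank_lt_card_of_det_eq_zero _ h0)
    refine Matrix.eq_zero_of_vecMul_eq_zero hdet ?_
    rw [Matrix.vecMul_sub, Matrix.vecMul_one, sub_eq_zero]
    exact hy.symm
  rw [V.finrank_eq_finrank_map_add_finrank_inf_ker side,
    (V ⊓ LinearMap.ker side).finrank_eq_finrank_map_add_finrank_inf_ker corner, hker, finrank_bot]
  omega

theorem theorem2 {F : Type*} [Field F] (n p r : ℕ) (hpn : p ≤ n) (hrp : r ≤ p) (hr : 0 < r)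
    (hF : ((r + 1 : ℕ) : Cardinal) < Cardinal.mk F) :
    IsGreatest
      {d : ℕ | ∃ S : AffineSubspace F (Matrix (Fin n) (Fin p) F),
        (S : Set (Matrix (Fin n) (Fin p) F)).Nonempty ∧
        (∀ M ∈ S, M.rank = r) ∧
        Module.finrank F S.direction = d}
      (r.choose 2 + r * (n - r)) := by
  refine ⟨exists_affineSubspace_rank_eq hpn hrp, ?_⟩
  rintro _ ⟨S, ⟨M₀, hM₀⟩, hS, rfl⟩
  obtain ⟨b, b', hb⟩ := LinearMap.exists_basis_toMatrix_eq_fromBlocks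
    (Matrix.toLin' M₀) (s := p - r) (t := n - r) (hS M₀ hM₀) (by simp; omega) (by simp; omega)
  let Φ : Matrix (Fin n) (Fin p) F ≃ₗ[F] Matrix (Fin r ⊕ Fin (n - r)) (Fin r ⊕ Fin (p - r)) F :=
    Matrix.toLin' ≪≫ₗ LinearMap.toMatrix b b'
  have hΦ : ∀ M, (Φ M).rank = M.rank := fun M ↦ by
    rw [Matrix.rank_eq_finrank_range_toLin _ b' b, LinearEquiv.trans_apply, Matrix.toLin_toMatrix]
    rfl
  have := finrank_le_of_forall_rank_eq (ι := Fin r) (κ := Fin (n - r)) (μ := Fin (p - r))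
    (by simpa using hF) (by simp; omega)
    (S.direction.map (Φ : Matrix (Fin n) (Fin p) F →ₗ[F] _)) (by
      rintro _ ⟨M, hM, rfl⟩
      rw [← hb, Fintype.card_fin]
      change (Φ M₀ + Φ M).rank = r
      rw [← map_add, hΦ, add_comm]
      exact hS _ (AffineSubspace.vadd_mem_of_mem_direction hM hM₀))
  rw [LinearEquiv.finrank_map_eq] at this
  simpa using this
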